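/- **Setting.** Consider the specification of the core functionality of the Ad hoc On-Demand Distance Vector (AODV, RFC 3561) routing protocol in the process algebra AWN (Algebra for Wireless Networks), without timing and optional features. A network is an encapsulated parallel composition of finitely many nodes with distinct addresses; each node runs the AODV process in parallel with a first-in-first-out message queue that is always able to receive. A node maintains its address, its own sequence number, a routing table, the set of route requests it has seen, and a store of queued data packets. Initially the sequence number is $1$, all other data are empty, and the transmission ranges are arbitrary. Transitions are the single execution steps of the nodes (assignments, evaluation of conditions, transmissions, deliveries, and the passing of a message from the queue to the main process), the submission of new data packets by the application layer, and the establishing or breaking of links; a message that is cast is put into the queue of every other node that is in range and is addressed. A state is *reachable* if it can be obtained from an initial state by finitely many transitions. A routing table $rt$ has at most one entry $(dip, dsn, dsk, flag, hops, nhip, pre)$ for each destination $dip$: a sequence number $dsn\in\mathbb N$ ($0$ meaning that none is known), a known/unknown status $dsk$ of it, a flag that is valid or invalid, a hop count $hops \in\mathbb N$, a next hop $nhip$ and a set $pre$ of precursors. Nodes treat routing tables as follows. (1) On receipt of a control message from a node $sip$, a route to $sip$ with sequence number $0$ (unknown), hop count $1$ and next hop $sip$ is used to update the table. (2) On receipt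 of a route request (RREQ) that has not been seen before, or of a route reply (RREP), with hop count $h$, the table is updated with the route of hop count $h+1$ and next hop $sip$ to the originator of the request, respectively to the destination of the reply, with the sequence number in the message, marked known. An update with a valid new route replaces an existing entry iff the new sequence number is larger, or it is equal and the new hop count is smaller or the old entry is invalid, or the new sequence number is unknown (then the old sequence number is kept); precursors are only ever added. (3) When a unicast to a next hop fails, all valid entries with this next hop are invalidated and their nonzero sequence numbers are incremented, and this is reported to the precursors in a route error message (RERR). (4) On receipt of an RERR from $sip$, the valid entries with next hop $sip$ whose sequence number is smaller than the one listed in the message are invalidated, take over the listed sequence number, and are reported further. Requests are answered by the destination, or by a node with a valid, known and sufficiently fresh entry, and are re-broadcast otherwise; replies are forwarded towards the originator of the request if they change the table. **Quality preorder.** The *net sequence number* of an entry is $\mathrm{nsqn}=dsn$ if the entry is valid or $dsn=0$, and $\mathrm{nsqn}=dsn-1$ otherwise. For routing tables $rt,rt'$ that both have an entry for $dip$, with net sequence numbers $n,n'$ and hop counts $h,h'$ of these entries, put $$rt\sqsubseteq_{dip} rt' \iff n<n' \ \text{ or }\ (n=n' \text{ and } h\ge h'),$$ and let $rt\sqsubset_{dip}rt'$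 mean that $rt\sqsubseteq_{dip}rt'$ but not $rt'\sqsubseteq_{dip}rt$. **Theorem.** Let $N$ be a reachable state of the network, let $ip$ and $nhip$ be nodes of the network and let $dip$ be an address. Suppose that in $N$ the routing tables of $ip$ and of $nhip$ both have a valid entry for $dip$, that $nhip$ is the next hop in $ip$'s entry for $dip$, and that $nhip\ne dip$. Then $$rt_{ip}\sqsubset_{dip} rt_{nhip},$$ where $rt_{ip}$ and $rt_{nhip}$ are the routing tables of $ip$ and $nhip$ in the state $N$. -/

import Mathlib

/-!
The AODV routing protocol, specified in the process algebra AWN.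

The file contains, in this order: the data structure of AODV; the sequential process
expressions of AWN with their operational semantics; the processes of AODV; nodes, networks and
the reachable network states; the quality preorder on routing tables.

Partial functions have values in `Option`.  An atomic formula with an undefined subterm is false,
and an action with an undefined argument is blocked.
-/

namespace AODV

/-! ### Data structure -/

/-- Sequence-number-status flag: known or unknown. -/
inductive SqnStatus where
  | kno
  | unk

/-- Route validity: valid or invalid. -/
inductive Flag where
  | val
  | inv

/-- Request-required flag of a queue of data packets: `req` says that a route request still has to
be sent, `noReq` that one has been sent already. -/
inductive ReqFlag where
  | noReq
  | req

/-- A routing table entry, without its destination, which is the argument of the routing table. -/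
structure Entry (IP : Type) where
  /-- destination sequence number -/
  dsn : ℕ
  /-- sequence-number-status flag -/
  dsk : SqnStatus
  /-- validity -/
  flag : Flag
  /-- hop count -/
  hops : ℕ
  /-- next hop -/
  nhip : IP
  /-- precursors -/
  pre : Set IP

/-- A routing table: at most one entry for each destination. -/
abbrev RT (IP : Type) := IP → Option (Entry IP)

/-- Unreachable destinations, each with a sequence number. -/
abbrev Dests (IP : Type) := IP → Option ℕ

/-- Store of queued data packets: at most one queue for each destination. -/
abbrev Store (IP Data : Type) := IP → Option (ReqFlag × List Data)

/-- Messages. -/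
inductive Msg (IP Data : Type) where
  | rreq (hops rreqid : ℕ) (dip : IP) (dsn : ℕ) (dsk : SqnStatus) (oip : IP) (osn : ℕ) (sip : IP)
  | rrep (hops : ℕ) (dip : IP) (dsn : ℕ) (oip sip : IP)
  | rerr (dests : Dests IP) (sip : IP)
  | newpkt (data : Data) (dip : IP)
  | pkt (data : Data) (dip oip : IP)

section Functions

variable {IP Data : Type}

/-- Increment of a sequence number; the unknown sequence number `0` is not incremented. -/
def inc (sn : ℕ) : ℕ := if sn = 0 then sn else sn + 1

/-- Destination sequence number; `0` if there is no entry. -/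
def sqn (rt : RT IP) (dip : IP) : ℕ :=
  match rt dip with
  | some r => r.dsn
  | none => 0

/-- Sequence-number status; unknown if there is no entry. -/
def sqnf (rt : RT IP) (dip : IP) : SqnStatus :=
  match rt dip with
  | some r => r.dsk
  | none => .unk

def dhops (rt : RT IP) (dip : IP) : Option ℕ := (rt dip).map Entry.hops

def nhop (rt : RT IP) (dip : IP) : Option IP := (rt dip).map Entry.nhip

def precs (rt : RT IP) (dip : IP) : Option (Set IP) := (rt dip).map Entry.pre

/-- Destinations with a valid entry. -/
def vD (rt : RT IP) : Set IP := {dip | ∃ r, rt dip = some r ∧ r.flag = .val}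

/-- Destinations with an invalid entry. -/
def iD (rt : RT IP) : Set IP := {dip | ∃ r, rt dip = some r ∧ r.flag = .inv}

/-- Adds precursors to an entry. -/
def addpre (r : Entry IP) (npre : Set IP) : Entry IP := { r with pre := r.pre ∪ npre }

open Classical in
/-- Adds precursors to the entry for `dip`; undefined if there is none. -/
noncomputable def addpreRT (rt : RT IP) (dip : IP) (npre : Set IP) : Option (RT IP) :=
  (rt dip).map fun r => Function.update rt dip (some (addpre r npre))

open Classical in
/-- Updates a routing table with a new entry `r` for the destination `dip`.  This is defined only
for a valid `r` whose sequence number is `0` iff it is unknown, and which has hop count `1` if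
its sequence number is unknown. -/
noncomputable def update (rt : RT IP) (dip : IP) (r : Entry IP) : Option (RT IP) :=
  if r.flag = .val ∧ (r.dsn = 0 ↔ r.dsk = .unk) ∧ (r.dsk = .unk → r.hops = 1) then
    some <| Function.update rt dip <| some <|
      match rt dip with
      | none => r
      | some s =>
        if s.dsn < r.dsn then addpre r s.pre
        else if s.dsn = r.dsn ∧ r.hops < s.hops then addpre r s.pre
        else if s.dsn = r.dsn ∧ s.flag = .inv then addpre r s.pre
        else if r.dsk = .unk then { addpre r s.pre with dsn := s.dsn }
        else addpre s r.pre
  else none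

/-- Invalidates the entries for the destinations in `dests`. -/
def invalidate (rt : RT IP) (dests : Dests IP) : RT IP := fun dip =>
  (rt dip).map fun r =>
    match dests dip with
    | some rsn => { r with dsn := rsn, flag := .inv }
    | none => r

open Classical in
/-- The valid destinations with the same next hop as `dip`, with incremented sequence numbers. -/
noncomputable def brokenDests (rt : RT IP) (dip : IP) : Dests IP := fun rip =>
  if rip ∈ vD rt ∧ ∃ nhip, nhop rt rip = some nhip ∧ nhop rt dip = some nhip
  then some (inc (sqn rt rip)) else none

open Classical in
/-- The part of an incoming set of unreachable destinations that affects the routing table. -/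
noncomputable def affectedDests (rt : RT IP) (dests : Dests IP) (sip : IP) : Dests IP := fun rip =>
  (dests rip).bind fun rsn =>
    if rip ∈ vD rt ∧ nhop rt rip = some sip ∧ sqn rt rip < rsn then some rsn else none

/-- All precursors of the destinations in `dests`. -/
def allPrecs (rt : RT IP) (dests : Dests IP) : Set IP :=
  {x | ∃ rip rsn P, dests rip = some rsn ∧ precs rt rip = some P ∧ x ∈ P}

open Classical in
/-- The destinations in `dests` that have a precursor. -/
noncomputable def withPrecs (rt : RT IP) (dests : Dests IP) : Dests IP := fun rip =>
  if ∃ P, precs rt rip = some P ∧ P ≠ ∅ then dests rip else none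

open Classical in
/-- The partial function defined at `dip` only. -/
noncomputable def singleDest (dip : IP) (sn : ℕ) : Dests IP := fun rip =>
  if rip = dip then some sn else none

open Classical in
/-- A fresh route request identifier. -/
noncomputable def nrreqid (rreqs : Finset (IP × ℕ)) (ip : IP) : ℕ :=
  (rreqs.filter fun x => x.1 = ip).sup Prod.snd + 1

/-- The queue of data packets for `dip`. -/
def selqueue (store : Store IP Data) (dip : IP) : List Data :=
  match store dip with
  | some (_, q) => q
  | none => []

/-- The destinations for which there are unsent packets. -/
def qD (store : Store IP Data) : Set IP := {dip | (store dip).isSome}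

/-- The request-required flag of the queue for `dip`. -/
def pflag (store : Store IP Data) (dip : IP) : Option ReqFlag := (store dip).map Prod.fst

open Classical in
/-- Adds a data packet for `dip` to the store. -/
noncomputable def add (data : Data) (dip : IP) (store : Store IP Data) : Store IP Data :=
  Function.update store dip <| some <|
    match store dip with
    | none => (.req, [data])
    | some (p, q) => (p, q ++ [data])

open Classical in
/-- Deletes the oldest data packet for `dip`; undefined if there is none. -/
noncomputable def drop (dip : IP) (store : Store IP Data) : Option (Store IP Data) :=
  match store dip with
  | some (_, [_]) => some (Function.update store dip none)
  | some (p, _ :: d :: q) => some (Function.update store dip (some (p, d :: q)))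
  | _ => none

open Classical in
/-- Records that a route request for `dip` has been initiated. -/
noncomputable def unsetRRF (store : Store IP Data) (dip : IP) : Store IP Data :=
  Function.update store dip ((store dip).map fun x => (.noReq, x.2))

/-- Records that route requests for the destinations in `dests` are required. -/
def setRRF (store : Store IP Data) (dests : Dests IP) : Store IP Data := fun dip =>
  match dests dip with
  | some _ => (store dip).map fun x => (.req, x.2)
  | none => store dip

end Functions

/-! ### Sequential processes of AWN -/

/-- Sequential process expressions, with addresses `IP`, application layer data `Data`, messages
`M`, process names (together with the values of their arguments) `X`, and valuations `σ` of the
variables that are maintained across process calls.  All other variables are replaced by their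
values as soon as they are bound: by a condition, an assignment or the receipt of a message. -/
inductive SeqProc (IP Data M X σ : Type) : Type 1 where
  /-- call of a named process -/
  | call (x : X)
  /-- choice -/
  | choice (p q : SeqProc IP Data M X σ)
  /-- condition; its free variables, collected in `α`, get any values that satisfy it -/
  | guard {α : Type} (φ : σ → α → Prop) (p : α → SeqProc IP Data M X σ)
  /-- assignment to a maintained variable -/
  | assign (u : σ → Option σ) (p : SeqProc IP Data M X σ)
  /-- assignment to any other variable -/
  | bind {α : Type} (e : σ → Option α) (p : α → SeqProc IP Data M X σ)
  | broadcast (ms : σ → Option M) (p : SeqProc IP Data M X σ)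
  | groupcast (ds : σ → Option (Set IP)) (ms : σ → Option M) (p : SeqProc IP Data M X σ)
  /-- unicast; continues as `p` if successful and as `q` otherwise -/
  | unicast (d : σ → Option IP) (ms : σ → Option M) (p q : SeqProc IP Data M X σ)
  | send (ms : σ → Option M) (p : SeqProc IP Data M X σ)
  | deliver (d : σ → Option Data) (p : SeqProc IP Data M X σ)
  | receive (p : M → SeqProc IP Data M X σ)

/-- A condition without free variables. -/
def SeqProc.cond {IP Data M X σ : Type} (φ : σ → Prop) (p : SeqProc IP Data M X σ) :
    SeqProc IP Data M X σ :=
  .guard (α := Unit) (fun ξ _ => φ ξ) (fun _ => p)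

/-- Actions of sequential processes. -/
inductive Act (IP Data M : Type) where
  | broadcast (m : M)
  | groupcast (ds : Set IP) (m : M)
  | unicast (d : IP) (m : M)
  | unicastFails (d : IP) (m : M)
  | send (m : M)
  | deliver (d : Data)
  | receive (m : M)
  | tau

/-- Transitions of sequential processes: `SeqStep defs ξ p a ξ' p'` says that `p` under the
valuation `ξ` can perform `a` and become `p'` under the valuation `ξ'`, where `defs` is the
defining equation of each process name. -/
inductive SeqStep {IP Data M X σ : Type} (defs : X → SeqProc IP Data M X σ) :
    σ → SeqProc IP Data M X σ → Act IP Data M → σ → SeqProc IP Data M X σ → Prop where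
  | call {ξ x a ξ' p'} (h : SeqStep defs ξ (defs x) a ξ' p') :
      SeqStep defs ξ (.call x) a ξ' p'
  | choiceLeft {ξ p q a ξ' p'} (h : SeqStep defs ξ p a ξ' p') :
      SeqStep defs ξ (.choice p q) a ξ' p'
  | choiceRight {ξ p q a ξ' q'} (h : SeqStep defs ξ q a ξ' q') :
      SeqStep defs ξ (.choice p q) a ξ' q'
  | guard {ξ} {α : Type} {φ : σ → α → Prop} {p} (x : α) (h : φ ξ x) :
      SeqStep defs ξ (.guard φ p) .tau ξ (p x)
  | assign {ξ u p ξ'} (h : u ξ = some ξ') :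
      SeqStep defs ξ (.assign u p) .tau ξ' p
  | bind {ξ} {α : Type} {e : σ → Option α} {p x} (h : e ξ = some x) :
      SeqStep defs ξ (.bind e p) .tau ξ (p x)
  | broadcast {ξ ms p m} (h : ms ξ = some m) :
      SeqStep defs ξ (.broadcast ms p) (.broadcast m) ξ p
  | groupcast {ξ ds ms p D m} (hd : ds ξ = some D) (hm : ms ξ = some m) :
      SeqStep defs ξ (.groupcast ds ms p) (.groupcast D m) ξ p
  | unicast {ξ d ms p q i m} (hd : d ξ = some i) (hm : ms ξ = some m) :
      SeqStep defs ξ (.unicast d ms p q) (.unicast i m) ξ p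
  | unicastFails {ξ d ms p q i m} (hd : d ξ = some i) (hm : ms ξ = some m) :
      SeqStep defs ξ (.unicast d ms p q) (.unicastFails i m) ξ q
  | send {ξ ms p m} (h : ms ξ = some m) :
      SeqStep defs ξ (.send ms p) (.send m) ξ p
  | deliver {ξ e p d} (h : e ξ = some d) :
      SeqStep defs ξ (.deliver e p) (.deliver d) ξ p
  | receive {ξ p} (m : M) :
      SeqStep defs ξ (.receive p) (.receive m) ξ (p m)

/-! ### The processes of AODV -/

/-- The variables maintained by a node. -/
structure Vars (IP Data : Type) where
  /-- own address -/
  ip : IP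
  /-- own sequence number -/
  sn : ℕ
  /-- routing table -/
  rt : RT IP
  /-- route requests seen, as pairs of originator and identifier -/
  rreqs : Finset (IP × ℕ)
  /-- queued data packets -/
  store : Store IP Data

/-- The names of the processes of AODV, with the arguments they have besides the maintained
variables `ip`, `sn`, `rt`, `rreqs` and `store`, which are passed on in every call. -/
inductive PName (IP Data : Type) where
  | aodv
  | newpkt (data : Data) (dip : IP)
  | pkt (data : Data) (dip oip : IP)
  | rreq (hops rreqid : ℕ) (dip : IP) (dsn : ℕ) (dsk : SqnStatus) (oip : IP) (osn : ℕ) (sip : IP)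
  | rrep (hops : ℕ) (dip : IP) (dsn : ℕ) (oip sip : IP)
  | rerr (dests : Dests IP) (sip : IP)

/-- Sequential processes over the maintained variables of a node. -/
abbrev Proc (IP Data : Type) := SeqProc IP Data (Msg IP Data) (PName IP Data) (Vars IP Data)

section Protocol

variable {IP Data : Type}

open SeqProc

/-- Assignment to the routing table. -/
def assignRT (u : Vars IP Data → Option (RT IP)) (p : Proc IP Data) : Proc IP Data :=
  assign (fun ξ => (u ξ).map fun rt => { ξ with rt := rt }) p

/-- Assignment to the store. -/
def assignStore (u : Vars IP Data → Option (Store IP Data)) (p : Proc IP Data) : Proc IP Data :=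
  assign (fun ξ => (u ξ).map fun store => { ξ with store := store }) p

/-- Assignment to the own sequence number. -/
def assignSN (u : Vars IP Data → ℕ) (p : Proc IP Data) : Proc IP Data :=
  assign (fun ξ => some { ξ with sn := u ξ }) p

open Classical in
/-- Addition of an element to the set of route requests seen. -/
noncomputable def addRreq (x : Vars IP Data → IP × ℕ) (p : Proc IP Data) : Proc IP Data :=
  assign (fun ξ => some { ξ with rreqs := insert (x ξ) ξ.rreqs }) p

/-- Invalidation of the routes in `dests`, followed by an error message to the precursors. -/
noncomputable def routeError (dests : Dests IP) : Proc IP Data :=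
  assignRT (fun ξ => some (invalidate ξ.rt dests)) <|
  assignStore (fun ξ => some (setRRF ξ.store dests)) <|
  bind (fun ξ => some (allPrecs ξ.rt dests)) fun pre =>
  bind (fun ξ => some (withPrecs ξ.rt dests)) fun dests' =>
  groupcast (fun _ => some pre) (fun ξ => some (.rerr dests' ξ.ip)) <|
  call .aodv

/-- Error handling after a failed unicast to the next hop towards `dip`. -/
noncomputable def linkBreak (dip : IP) : Proc IP Data :=
  bind (fun ξ => some (brokenDests ξ.rt dip)) routeError

/-- Update of the route to the sender of a control message. -/
noncomputable def updateSender (sip : IP) (p : Proc IP Data) : Proc IP Data :=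
  assignRT (fun ξ => update ξ.rt sip ⟨0, .unk, .val, 1, sip, ∅⟩) p

/-- The basic routine. -/
noncomputable def AODVdef : Proc IP Data :=
  choice
    (receive fun msg =>
      choice
        (guard (fun _ (data, dip) => msg = .newpkt data dip) fun (data, dip) =>
          call (.newpkt data dip)) <|
      choice
        (guard (fun _ (data, dip, oip) => msg = .pkt data dip oip) fun (data, dip, oip) =>
          call (.pkt data dip oip)) <|
      choice
        (guard
          (fun _ (hops, rreqid, dip, dsn, dsk, oip, osn, sip) =>
            msg = .rreq hops rreqid dip dsn dsk oip osn sip)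
          fun (hops, rreqid, dip, dsn, dsk, oip, osn, sip) =>
            updateSender sip <|
            call (.rreq hops rreqid dip dsn dsk oip osn sip)) <|
      choice
        (guard (fun _ (hops, dip, dsn, oip, sip) => msg = .rrep hops dip dsn oip sip)
          fun (hops, dip, dsn, oip, sip) =>
            updateSender sip <|
            call (.rrep hops dip dsn oip sip))
        (guard (fun _ (dests, sip) => msg = .rerr dests sip) fun (dests, sip) =>
          updateSender sip <|
          call (.rerr dests sip))) <|
  choice
    -- send a queued data packet
    (guard (fun ξ dip => dip ∈ qD ξ.store ∩ vD ξ.rt) fun dip =>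
      bind (fun ξ => (selqueue ξ.store dip).head?) fun data =>
      unicast (fun ξ => nhop ξ.rt dip) (fun ξ => some (.pkt data dip ξ.ip))
        (assignStore (fun ξ => drop dip ξ.store) <|
          call .aodv)
        (linkBreak dip))
    -- initiate a route discovery
    (guard (fun ξ dip => dip ∈ qD ξ.store \ vD ξ.rt ∧ pflag ξ.store dip = some .req) fun dip =>
      assignStore (fun ξ => some (unsetRRF ξ.store dip)) <|
      assignSN (fun ξ => inc ξ.sn) <|
      bind (fun ξ => some (nrreqid ξ.rreqs ξ.ip)) fun rreqid =>
      addRreq (fun ξ => (ξ.ip, rreqid)) <|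
      broadcast
        (fun ξ => some (.rreq 0 rreqid dip (sqn ξ.rt dip) (sqnf ξ.rt dip) ξ.ip ξ.sn ξ.ip)) <|
      call .aodv)

/-- Handling of a data packet injected by the application layer. -/
noncomputable def NEWPKTdef (data : Data) (dip : IP) : Proc IP Data :=
  choice
    (cond (fun ξ => dip = ξ.ip) <|
      deliver (fun _ => some data) <|
      call .aodv)
    (cond (fun ξ => dip ≠ ξ.ip) <|
      assignStore (fun ξ => some (add data dip ξ.store)) <|
      call .aodv)

/-- Handling of a data packet received from another node. -/
noncomputable def PKTdef (data : Data) (dip oip : IP) : Proc IP Data :=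
  choice
    (cond (fun ξ => dip = ξ.ip) <|
      deliver (fun _ => some data) <|
      call .aodv)
    (cond (fun ξ => dip ≠ ξ.ip) <|
      choice
        (cond (fun ξ => dip ∈ vD ξ.rt) <|
          unicast (fun ξ => nhop ξ.rt dip) (fun _ => some (.pkt data dip oip))
            (call .aodv)
            (linkBreak dip))
        (cond (fun ξ => dip ∉ vD ξ.rt) <|
          choice
            (cond (fun ξ => dip ∈ iD ξ.rt) <|
              groupcast (fun ξ => precs ξ.rt dip)
                (fun ξ => some (.rerr (singleDest dip (sqn ξ.rt dip)) ξ.ip)) <|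
              call .aodv)
            (cond (fun ξ => dip ∉ iD ξ.rt) <|
              call .aodv)))

/-- Handling of a route request. -/
noncomputable def RREQdef (hops rreqid : ℕ) (dip : IP) (dsn : ℕ) (dsk : SqnStatus) (oip : IP)
    (osn : ℕ) (sip : IP) : Proc IP Data :=
  choice
    (cond (fun ξ => (oip, rreqid) ∈ ξ.rreqs) <|
      call .aodv)
    (cond (fun ξ => (oip, rreqid) ∉ ξ.rreqs) <|
      assignRT (fun ξ => update ξ.rt oip ⟨osn, .kno, .val, hops + 1, sip, ∅⟩) <|
      addRreq (fun _ => (oip, rreqid)) <|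
      choice
        (cond (fun ξ => dip = ξ.ip) <|
          assignSN (fun ξ => max ξ.sn dsn) <|
          unicast (fun ξ => nhop ξ.rt oip) (fun ξ => some (.rrep 0 dip ξ.sn oip ξ.ip))
            (call .aodv)
            (linkBreak oip))
        (cond (fun ξ => dip ≠ ξ.ip) <|
          choice
            (cond (fun ξ => dip ∈ vD ξ.rt ∧ dsn ≤ sqn ξ.rt dip ∧ sqnf ξ.rt dip = .kno) <|
              assignRT (fun ξ => addpreRT ξ.rt dip {sip}) <|
              assignRT (fun ξ => (nhop ξ.rt dip).bind fun nh => addpreRT ξ.rt oip {nh}) <|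
              unicast (fun ξ => nhop ξ.rt oip)
                (fun ξ => (dhops ξ.rt dip).map fun h => .rrep h dip (sqn ξ.rt dip) oip ξ.ip)
                (call .aodv)
                (linkBreak oip))
            (cond (fun ξ => dip ∉ vD ξ.rt ∨ sqn ξ.rt dip < dsn ∨ sqnf ξ.rt dip = .unk) <|
              broadcast
                (fun ξ => some
                  (.rreq (hops + 1) rreqid dip (max (sqn ξ.rt dip) dsn) dsk oip osn ξ.ip)) <|
              call .aodv)))

/-- Handling of a route reply. -/
noncomputable def RREPdef (hops : ℕ) (dip : IP) (dsn : ℕ) (oip sip : IP) : Proc IP Data :=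
  choice
    (cond (fun ξ => ∃ rt', update ξ.rt dip ⟨dsn, .kno, .val, hops + 1, sip, ∅⟩ = some rt' ∧
        ξ.rt ≠ rt') <|
      assignRT (fun ξ => update ξ.rt dip ⟨dsn, .kno, .val, hops + 1, sip, ∅⟩) <|
      choice
        (cond (fun ξ => oip = ξ.ip) <|
          call .aodv)
        (cond (fun ξ => oip ≠ ξ.ip) <|
          choice
            (cond (fun ξ => oip ∈ vD ξ.rt) <|
              assignRT (fun ξ => (nhop ξ.rt oip).bind fun nh => addpreRT ξ.rt dip {nh}) <|
              assignRT (fun ξ => (nhop ξ.rt oip).bind fun nh =>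
                (nhop ξ.rt dip).bind fun nh' => addpreRT ξ.rt nh' {nh}) <|
              unicast (fun ξ => nhop ξ.rt oip)
                (fun ξ => some (.rrep (hops + 1) dip dsn oip ξ.ip))
                (call .aodv)
                (linkBreak oip))
            (cond (fun ξ => oip ∉ vD ξ.rt) <|
              call .aodv)))
    (cond (fun ξ => update ξ.rt dip ⟨dsn, .kno, .val, hops + 1, sip, ∅⟩ = some ξ.rt) <|
      call .aodv)

/-- Handling of a route error message. -/
noncomputable def RERRdef (dests : Dests IP) (sip : IP) : Proc IP Data :=
  bind (fun ξ => some (affectedDests ξ.rt dests sip)) routeError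

/-- The defining equations of the processes of AODV. -/
noncomputable def aodvDefs : PName IP Data → Proc IP Data
  | .aodv => AODVdef
  | .newpkt data dip => NEWPKTdef data dip
  | .pkt data dip oip => PKTdef data dip oip
  | .rreq hops rreqid dip dsn dsk oip osn sip => RREQdef hops rreqid dip dsn dsk oip osn sip
  | .rrep hops dip dsn oip sip => RREPdef hops dip dsn oip sip
  | .rerr dests sip => RERRdef dests sip

/-- Process expressions of the message queue; the argument of its only process name is the list of
queued messages, the oldest one first. -/
abbrev QProc (IP Data : Type) :=
  SeqProc IP Data (Msg IP Data) (List (Msg IP Data)) Unit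

/-- The message queue. -/
def qmsgDefs (msgs : List (Msg IP Data)) : QProc IP Data :=
  choice
    (receive fun msg => call (msgs ++ [msg]))
    (cond (fun _ => msgs ≠ []) <|
      choice
        (send (fun _ => msgs.head?) <| call msgs.tail)
        (receive fun msg => call (msgs ++ [msg])))

end Protocol

/-! ### Nodes and networks -/

/-- The state of a node: the valuation and the state of its main process, the state of its message
queue, and the set of addresses that are currently within its transmission range. -/
structure NodeState (IP Data : Type) where
  vars : Vars IP Data
  proc : Proc IP Data
  queue : QProc IP Data
  range : Set IP

section Networks

variable {IP Data : Type}

/-- Transitions of the parallel composition of main process and message queue: messages are piped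
from the queue to the main process, and messages from outside are received by the queue. -/
inductive ParStep : NodeState IP Data → Act IP Data (Msg IP Data) → NodeState IP Data → Prop where
  | main {s a ξ' p'} (ha : ∀ m, a ≠ .receive m)
      (h : SeqStep aodvDefs s.vars s.proc a ξ' p') :
      ParStep s a { s with vars := ξ', proc := p' }
  | queue {s a q'} (ha : ∀ m, a ≠ .send m)
      (h : SeqStep qmsgDefs () s.queue a () q') :
      ParStep s a { s with queue := q' }
  | sync {s m ξ' p' q'}
      (hp : SeqStep aodvDefs s.vars s.proc (.receive m) ξ' p')
      (hq : SeqStep qmsgDefs () s.queue (.send m) () q') :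
      ParStep s .tau { s with vars := ξ', proc := p', queue := q' }

/-- Actions of a node: transmission of a message to a set of addresses, an internal action, delivery
of data to the application layer, arrival of a message. -/
inductive NodeAct (IP Data : Type) where
  | cast (D : Set IP) (m : Msg IP Data)
  | tau
  | deliver (d : Data)
  | arrive (m : Msg IP Data)

/-- Transitions of a node. -/
inductive NodeStep : NodeState IP Data → NodeAct IP Data → NodeState IP Data → Prop where
  | broadcast {s m s'} (h : ParStep s (.broadcast m) s') :
      NodeStep s (.cast s.range m) s'
  | groupcast {s D m s'} (h : ParStep s (.groupcast D m) s') :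
      NodeStep s (.cast (s.range ∩ D) m) s'
  | unicast {s d m s'} (h : ParStep s (.unicast d m) s') (hd : d ∈ s.range) :
      NodeStep s (.cast {d} m) s'
  | unicastFails {s d m s'} (h : ParStep s (.unicastFails d m) s') (hd : d ∉ s.range) :
      NodeStep s .tau s'
  | tau {s s'} (h : ParStep s .tau s') : NodeStep s .tau s'
  | deliver {s d s'} (h : ParStep s (.deliver d) s') : NodeStep s (.deliver d) s'
  | arrive {s m s'} (h : ParStep s (.receive m) s') : NodeStep s (.arrive m) s'

/-- A state of a network with the given finite set of (uniquely addressed) nodes. -/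
abbrev Network (nodes : Finset IP) (Data : Type) := nodes → NodeState IP Data

/-- The routing table of a node in a network state. -/
def Network.rt {nodes : Finset IP} (N : Network nodes Data) (ip : nodes) : RT IP :=
  (N ip).vars.rt

/-- The range of the node `ip` after a link between `a` and `b` has been established. -/
def connectRange (a b ip : IP) (R : Set IP) : Set IP :=
  R ∪ {x | (ip = a ∧ x = b) ∨ (ip = b ∧ x = a)}

/-- The range of the node `ip` after the link between `a` and `b` has broken. -/
def disconnectRange (a b ip : IP) (R : Set IP) : Set IP :=
  R \ {x | (ip = a ∧ x = b) ∨ (ip = b ∧ x = a)}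

/-- Transitions of an encapsulated network. -/
inductive NetStep {nodes : Finset IP} : Network nodes Data → Network nodes Data → Prop where
  /-- A message is cast by one node and received by all other nodes among its destinations. -/
  | cast {N N' : Network nodes Data} (i : nodes) {D m}
      (hi : NodeStep (N i) (.cast D m) (N' i))
      (hin : ∀ j, j ≠ i → (j : IP) ∈ D → NodeStep (N j) (.arrive m) (N' j))
      (hout : ∀ j, j ≠ i → (j : IP) ∉ D → N' j = N j) : NetStep N N'
  | tau {N N' : Network nodes Data} (i : nodes)
      (hi : NodeStep (N i) .tau (N' i)) (hout : ∀ j, j ≠ i → N' j = N j) : NetStep N N'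
  | deliver {N N' : Network nodes Data} (i : nodes) {d}
      (hi : NodeStep (N i) (.deliver d) (N' i)) (hout : ∀ j, j ≠ i → N' j = N j) : NetStep N N'
  /-- A new data packet is submitted to a node by its application layer. -/
  | newpkt {N N' : Network nodes Data} (i : nodes) {data dip}
      (hi : NodeStep (N i) (.arrive (.newpkt data dip)) (N' i))
      (hout : ∀ j, j ≠ i → N' j = N j) : NetStep N N'
  | connect {N : Network nodes Data} (a b : IP) :
      NetStep N fun i => { N i with range := connectRange a b i (N i).range }
  | disconnect {N : Network nodes Data} (a b : IP) :
      NetStep N fun i => { N i with range := disconnectRange a b i (N i).range }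

/-- Initial states; the transmission ranges are arbitrary. -/
def Initial {nodes : Finset IP} (N : Network nodes Data) : Prop :=
  ∀ i : nodes,
    (N i).vars = { ip := i, sn := 1, rt := fun _ => none, rreqs := ∅, store := fun _ => none } ∧
    (N i).proc = .call .aodv ∧ (N i).queue = .call []

/-- Network states that can be reached from an initial state. -/
def Reachable {nodes : Finset IP} (N : Network nodes Data) : Prop :=
  ∃ N₀ : Network nodes Data, Initial N₀ ∧ Relation.ReflTransGen NetStep N₀ N

end Networks

/-! ### The quality of routing table entries -/

section Quality

variable {IP : Type}

open Classical in
/-- Net sequence number of an entry. -/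
noncomputable def Entry.nsqn (r : Entry IP) : ℕ :=
  if r.flag = .val ∨ r.dsn = 0 then r.dsn else r.dsn - 1

/-- Quality preorder on entries for the same destination. -/
def Entry.QualityLE (r r' : Entry IP) : Prop :=
  r.nsqn < r'.nsqn ∨ (r.nsqn = r'.nsqn ∧ r.hops ≥ r'.hops)

/-- Quality preorder for the destination `dip` on routing tables with an entry for `dip`. -/
def QualityLE (dip : IP) (rt rt' : RT IP) : Prop :=
  ∃ r r', rt dip = some r ∧ rt' dip = some r' ∧ r.QualityLE r'

/-- The equivalence relation induced by the quality preorder. -/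
def QualityEquiv (dip : IP) (rt rt' : RT IP) : Prop :=
  QualityLE dip rt rt' ∧ QualityLE dip rt' rt

/-- The strict version of the quality preorder. -/
def QualityLT (dip : IP) (rt rt' : RT IP) : Prop :=
  QualityLE dip rt rt' ∧ ¬ QualityEquiv dip rt rt'

end Quality

end AODV

namespace AODV

/-! ### Safety of sequential processes -/

/-! From a node to its next hop, the sequence number grows or the hop count drops. The difficulty is
that an entry stems from a message sent in the past, after which the sender may have replaced or
invalidated its own route. The remedy is a notion of quality that is never lost: `Offers rt dip sn
h` compares raw sequence numbers, and asks for validity and at most `h` hops only when they are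
equal. Table updates respect old offers (`update_offersLE`), and invalidation strictly raises every
known number (`invalidate_offersLE`).

Hence the set `Network.facts` of all current offers only grows, and evidence found once stays good,
however long a message waits in a queue. The invariant `Network.Inv` has two sides. A valid entry
whose next hop is not the destination rests on an offer by that next hop, with the same number and
strictly fewer hops (`Justified`). A request or reply in transit rests on an offer by its sender,
unless the sender is the destination of the advertised route (`Msg.Sound`). Senders advertise only
what their tables offer (`update_offers`, `offers_of_mem_vD`), and receivers add one hop
(`Justified.update`).

The control flow is treated once and for all: `SeqStep.safe` reduces the invariant to checking each
defining equation against a contract (`aodvDefs_safe`). In the end both entries are valid, net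
sequence numbers are plain ones, and the offer of the next hop is the strict inequality. -/

/-- Requirements on the calls, assignments, outputs and inputs of a sequential process, relative to
a world `w` that records what is known. -/
structure Contract (W M X σ : Type) where
  /-- precondition of a call -/
  call : W → X → Prop
  /-- relation between the valuations before and after an assignment -/
  assign : W → σ → σ → Prop
  /-- condition on messages that are broadcast, groupcast or unicast -/
  cast : W → σ → M → Prop
  /-- condition on messages that are sent inside the node -/
  send : W → σ → M → Prop
  /-- condition on received messages -/
  inp : W → M → Prop

/-- A contract whose obligations persist when the world grows. -/
structure Contract.Persistent {W M X σ : Type} [Preorder W] (S : Contract W M X σ) : Prop where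
  call : ∀ {w w' x}, w ≤ w' → S.call w x → S.call w' x
  assign : ∀ {w w' ξ ξ'}, w ≤ w' → S.assign w ξ ξ' → S.assign w' ξ ξ'
  cast : ∀ {w w' ξ m}, w ≤ w' → S.cast w ξ m → S.cast w' ξ m
  send : ∀ {w w' ξ m}, w ≤ w' → S.send w ξ m → S.send w' ξ m

section Safety

variable {IP Data M X σ W : Type} [Preorder W]

/-- A process is safe if it meets the contract up to its next calls. -/
def SeqProc.Safe (S : Contract W M X σ) : SeqProc IP Data M X σ → W → σ → Prop
  | .call x, w, _ => S.call w x
  | .choice p q, w, ξ => p.Safe S w ξ ∧ q.Safe S w ξ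
  | .guard φ p, w, ξ => ∀ x, φ ξ x → (p x).Safe S w ξ
  | .assign u p, w, ξ => ∀ ξ', u ξ = some ξ' → S.assign w ξ ξ' ∧ p.Safe S w ξ'
  | .bind e p, w, ξ => ∀ x, e ξ = some x → (p x).Safe S w ξ
  | .broadcast ms p, w, ξ => (∀ m, ms ξ = some m → S.cast w ξ m) ∧ p.Safe S w ξ
  | .groupcast _ ms p, w, ξ => (∀ m, ms ξ = some m → S.cast w ξ m) ∧ p.Safe S w ξ
  | .unicast _ ms p q, w, ξ =>
      (∀ m, ms ξ = some m → S.cast w ξ m) ∧ p.Safe S w ξ ∧ q.Safe S w ξ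
  | .send ms p, w, ξ => (∀ m, ms ξ = some m → S.send w ξ m) ∧ p.Safe S w ξ
  | .deliver _ p, w, ξ => p.Safe S w ξ
  | .receive p, w, ξ => ∀ w', w ≤ w' → ∀ m, S.inp w' m → (p m).Safe S w' ξ

/-- Other nodes move while a process stands still, so safety has to survive growth of the world. A
waiting `receive` is safe in all larger worlds by definition, so transitivity suffices there. -/
theorem SeqProc.Safe.mono {S : Contract W M X σ} (hS : S.Persistent)
    {p : SeqProc IP Data M X σ} {w w' : W} {ξ : σ} (hw : w ≤ w') (h : p.Safe S w ξ) :
    p.Safe S w' ξ := by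
  induction p generalizing ξ with
  | call x => exact hS.call hw h
  | choice p q ihp ihq => exact ⟨ihp h.1, ihq h.2⟩
  | guard φ p ih => exact fun x hx => ih x (h x hx)
  | assign u p ih => exact fun ξ' hu => ⟨hS.assign hw (h ξ' hu).1, ih (h ξ' hu).2⟩
  | bind e p ih => exact fun x hx => ih x (h x hx)
  | broadcast ms p ih => exact ⟨fun m hm => hS.cast hw (h.1 m hm), ih h.2⟩
  | groupcast ds ms p ih => exact ⟨fun m hm => hS.cast hw (h.1 m hm), ih h.2⟩
  | unicast d ms p q ihp ihq =>
    exact ⟨fun m hm => hS.cast hw (h.1 m hm), ihp h.2.1, ihq h.2.2⟩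
  | send ms p ih => exact ⟨fun m hm => hS.send hw (h.1 m hm), ih h.2⟩
  | deliver d p ih => exact ih h
  | receive p ih => exact fun w'' hw' m hm => h w'' (hw.trans hw') m hm

/-- The message that an action casts to other nodes. -/
def Act.castMsg : Act IP Data M → Option M
  | .broadcast m | .groupcast _ m | .unicast _ m => some m
  | _ => none

/-- A step of a safe process meets the contract and leads to a safe process. -/
theorem SeqStep.safe {S : Contract W M X σ} {defs : X → SeqProc IP Data M X σ} {w : W} {ξ ξ' : σ}
    {p p' : SeqProc IP Data M X σ} {a : Act IP Data M} (h : SeqStep defs ξ p a ξ' p')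
    (hdefs : ∀ x, S.call w x → (defs x).Safe S w ξ) (ha : ∀ m, a = .receive m → S.inp w m)
    (hp : p.Safe S w ξ) :
    (ξ' = ξ ∨ S.assign w ξ ξ') ∧ p'.Safe S w ξ' ∧
      (∀ m, a.castMsg = some m → S.cast w ξ m) ∧ ∀ m, a = .send m → S.send w ξ m := by
  induction h with
  | call h ih => exact ih ha (hdefs _ hp)
  | choiceLeft h ih => exact ih ha hp.1
  | choiceRight h ih => exact ih ha hp.2
  | guard x h => exact ⟨.inl rfl, hp x h, nofun, nofun⟩
  | assign h => exact ⟨.inr (hp _ h).1, (hp _ h).2, nofun, nofun⟩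
  | bind h => exact ⟨.inl rfl, hp _ h, nofun, nofun⟩
  | broadcast h => exact ⟨.inl rfl, hp.2, fun m hm => hp.1 m (h.trans hm), nofun⟩
  | groupcast hd h => exact ⟨.inl rfl, hp.2, fun m hm => hp.1 m (h.trans hm), nofun⟩
  | unicast hd h => exact ⟨.inl rfl, hp.2.1, fun m hm => hp.1 m (h.trans hm), nofun⟩
  | unicastFails hd h => exact ⟨.inl rfl, hp.2.2, nofun, nofun⟩
  | send h => exact ⟨.inl rfl, hp.2, nofun, fun m hm => by cases hm; exact hp.1 _ h⟩
  | deliver h => exact ⟨.inl rfl, hp, nofun, nofun⟩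
  | receive m => exact ⟨.inl rfl, hp _ le_rfl m (ha m rfl), nofun, nofun⟩

end Safety

/-! ### Lower bounds on the quality of routing tables -/

section Bounds

variable {IP Data : Type}

/-- The route to `dip` is at least as good as one with the known sequence number `sn` and the hop
count `h`, or has been so before its invalidation. -/
def Offers (rt : RT IP) (dip : IP) (sn h : ℕ) : Prop :=
  sn ≠ 0 → ∃ r, rt dip = some r ∧ (sn < r.dsn ∨ sn = r.dsn ∧ r.hops ≤ h ∧ r.flag = .val)

/-- Everything offered by the first routing table is offered by the second one. -/
def OffersLE (rt rt' : RT IP) : Prop := ∀ dip sn h, Offers rt dip sn h → Offers rt' dip sn h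

theorem OffersLE.refl (rt : RT IP) : OffersLE rt rt := fun _ _ _ h => h

/-- A set of facts `F sip dip sn h`, read as: the node `sip` offers a route to `dip` with sequence
number `sn` and hop count `h`. -/
abbrev Facts (IP : Type) := IP → IP → ℕ → ℕ → Prop

/-- The hop counts in the routing table are positive, and the next hop on each valid route either is
the destination or offers a strictly shorter route. -/
def Justified (F : Facts IP) (rt : RT IP) : Prop :=
  ∀ dip r, rt dip = some r → 1 ≤ r.hops ∧
    (r.flag = .val → r.nhip ≠ dip → r.dsn ≠ 0 ∧ ∃ h < r.hops, F r.nhip dip r.dsn h)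

theorem Justified.mono {F F' : Facts IP} {rt : RT IP} (hF : F ≤ F') (h : Justified F rt) :
    Justified F' rt := fun dip r hr =>
  ⟨(h dip r hr).1, fun hv hn =>
    let ⟨h0, k, hk, hf⟩ := (h dip r hr).2 hv hn
    ⟨h0, k, hk, hF _ _ _ _ hf⟩⟩

/-- The sender of the message is the destination of the advertised route, or offers this route. -/
def Msg.Sound (F : Facts IP) : Msg IP Data → Prop
  | .rreq hops _ _ _ _ oip osn sip => sip ≠ oip → F sip oip osn hops
  | .rrep hops dip dsn _ sip => sip ≠ dip → F sip dip dsn hops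
  | _ => True

theorem Msg.Sound.mono {F F' : Facts IP} (hF : F ≤ F') {m : Msg IP Data} (h : m.Sound F) :
    m.Sound F' := by
  cases m <;> first | exact trivial | exact fun hne => hF _ _ _ _ (h hne)

/-! ### Effect of the routing table operations on offers and justifications -/

-- A rejected route with known number leaves an entry at least as good: its number is larger, or
-- equal with no more hops and a valid flag. So a node may pass on an advertised route even if its
-- table keeps another one.
open Classical in
theorem update_offers {rt rt' : RT IP} {dip : IP} {r : Entry IP} (hu : update rt dip r = some rt')
    (hk : r.dsk = .kno) : Offers rt' dip r.dsn r.hops := by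
  unfold update at hu
  obtain ⟨hr, hu⟩ := Option.ite_none_right_eq_some.1 hu
  cases hu
  intro _
  refine ⟨_, Function.update_self .., ?_⟩
  split
  · exact .inr ⟨rfl, le_rfl, hr.1⟩
  · rename_i s _
    split_ifs with h1 h2 h3 h4
    · exact .inr ⟨rfl, le_rfl, hr.1⟩
    · exact .inr ⟨rfl, le_rfl, hr.1⟩
    · exact .inr ⟨rfl, le_rfl, hr.1⟩
    · simp [hk] at h4
    · rcases lt_or_eq_of_le (not_lt.1 h1) with h | h
      · exact .inl h
      · refine .inr ⟨h, by simpa [addpre] using fun h' => h2 ⟨h.symm, h'⟩, ?_⟩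
        cases hf : s.flag
        · exact hf
        · exact absurd ⟨h.symm, hf⟩ h3

-- At equal numbers, a replacement shortens the route or revives an invalid entry. Revival may
-- lengthen the route, but an invalid entry makes no offer at its own number; this is why `Offers`
-- demands validity in the case of equality. `Justified` enters only through positive hop counts.
open Classical in
theorem update_offersLE {F : Facts IP} {rt rt' : RT IP} {dip : IP} {r : Entry IP}
    (hrt : Justified F rt) (hu : update rt dip r = some rt') : OffersLE rt rt' := by
  unfold update at hu
  obtain ⟨hr, hu⟩ := Option.ite_none_right_eq_some.1 hu
  cases hu
  intro d sn h ho h0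
  obtain ⟨s, hs, hq⟩ := ho h0
  by_cases hd : d = dip
  · subst hd
    have hpos := (hrt d s hs).1
    refine ⟨_, Function.update_self .., ?_⟩
    simp only [hs]
    obtain ⟨hv, -, h1⟩ := hr
    split_ifs with c1 c2 c3 c4
    · left; simp only [addpre]; omega
    · rcases hq with hq | hq
      · left; simp only [addpre]; omega
      · right; exact ⟨by simp only [addpre]; omega, by simp only [addpre]; omega, hv⟩
    · rcases hq with hq | hq
      · left; simp only [addpre]; omega
      · simp [c3.2] at hq
    · rcases hq with hq | hq
      · exact .inl hq
      -- An unknown number forces hop count `1`, which positivity bounds by the old hop count; the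
      -- old number is kept.
      · have := h1 c4
        exact .inr ⟨hq.1, by simp only [addpre]; omega, hv⟩
    · exact hq
  · exact ⟨s, by rwa [Function.update_of_ne hd], hq⟩

open Classical in
theorem Justified.update {F : Facts IP} {rt rt' : RT IP} {dip : IP} {r : Entry IP}
    (hrt : Justified F rt) (hu : update rt dip r = some rt') (hpos : 1 ≤ r.hops)
    (hr : r.nhip ≠ dip → r.dsk = .kno ∧ ∃ h < r.hops, F r.nhip dip r.dsn h) :
    Justified F rt' := by
  unfold AODV.update at hu
  obtain ⟨hc, hu⟩ := Option.ite_none_right_eq_some.1 hu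
  cases hu
  intro d e he
  by_cases hd : d = dip
  · subst hd
    rw [Function.update_self, Option.some_inj] at he
    -- Every branch installing `r` with its own number changes at most the precursors. The number is
    -- nonzero because `update` is defined only if `0` goes with status unknown.
    have new (e : Entry IP) (h1 : e.hops = r.hops) (h2 : e.nhip = r.nhip) (h3 : e.dsn = r.dsn) :
        1 ≤ e.hops ∧ (e.flag = .val → e.nhip ≠ d → e.dsn ≠ 0 ∧ ∃ h < e.hops, F e.nhip d e.dsn h) := by
      rw [h1, h2, h3]
      refine ⟨hpos, fun _ hn => ⟨fun h0 => ?_, (hr hn).2⟩⟩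
      have := hc.2.1.1 h0
      simp [(hr hn).1] at this
    cases hs : rt d with
    | none =>
      simp only [hs] at he
      subst he
      exact new _ rfl rfl rfl
    | some s =>
      simp only [hs] at he
      split_ifs at he with c1 c2 c3 c4
      · subst he; exact new _ rfl rfl rfl
      · subst he; exact new _ rfl rfl rfl
      · subst he; exact new _ rfl rfl rfl
      · subst he
        refine ⟨hpos, fun _ hn => ?_⟩
        have := (hr hn).1
        simp [c4] at this
      · subst he
        exact hrt d s hs
  · rw [Function.update_of_ne hd] at he
    exact hrt d e he

open Classical in
theorem addpreRT_offersLE {rt rt' : RT IP} {dip : IP} {npre : Set IP}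
    (hu : addpreRT rt dip npre = some rt') : OffersLE rt rt' := by
  obtain ⟨r, hr, rfl⟩ := Option.map_eq_some_iff.1 hu
  intro d sn h ho h0
  obtain ⟨s, hs, hq⟩ := ho h0
  by_cases hd : d = dip
  · subst hd
    obtain rfl : r = s := Option.some_inj.1 (hr.symm.trans hs)
    exact ⟨_, Function.update_self .., hq⟩
  · exact ⟨s, by rwa [Function.update_of_ne hd], hq⟩

open Classical in
theorem addpreRT_vD {rt rt' : RT IP} {dip d : IP} {npre : Set IP}
    (hu : addpreRT rt dip npre = some rt') (hd : d ∈ vD rt) : d ∈ vD rt' := by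
  obtain ⟨r, hr, rfl⟩ := Option.map_eq_some_iff.1 hu
  obtain ⟨s, hs, hv⟩ := hd
  by_cases hd : d = dip
  · subst hd
    obtain rfl : r = s := Option.some_inj.1 (hr.symm.trans hs)
    exact ⟨_, Function.update_self .., hv⟩
  · exact ⟨s, by rwa [Function.update_of_ne hd], hv⟩

theorem offers_of_mem_vD {rt : RT IP} {dip : IP} {h : ℕ} (hd : dip ∈ vD rt)
    (hh : dhops rt dip = some h) : Offers rt dip (sqn rt dip) h := by
  obtain ⟨r, hr, hv⟩ := hd
  have hle : r.hops = h := by simpa [dhops, hr] using hh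
  exact fun _ => ⟨r, hr, .inr ⟨by simp [sqn, hr], hle.le, hv⟩⟩

open Classical in
theorem Justified.addpreRT {F : Facts IP} {rt rt' : RT IP} {dip : IP} {npre : Set IP}
    (hrt : Justified F rt) (hu : addpreRT rt dip npre = some rt') : Justified F rt' := by
  obtain ⟨r, hr, rfl⟩ := Option.map_eq_some_iff.1 hu
  intro d e he
  by_cases hd : d = dip
  · subst hd
    rw [Function.update_self, Option.some_inj] at he
    subst he
    exact hrt d r hr
  · rw [Function.update_of_ne hd] at he
    exact hrt d e he

/-- Every known sequence number is smaller than the one in `dests` for the same destination. -/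
def Exceeds (dests : Dests IP) (rt : RT IP) : Prop :=
  ∀ dip rsn r, dests dip = some rsn → rt dip = some r → r.dsn ≠ 0 → r.dsn < rsn

/-- The raised number beats every earlier offer, so losing validity costs nothing. `Exceeds` may
ignore the number `0`, since offers with that number are void. -/
theorem invalidate_offersLE {rt : RT IP} {dests : Dests IP} (hd : Exceeds dests rt) :
    OffersLE rt (invalidate rt dests) := by
  intro d sn h ho h0
  obtain ⟨s, hs, hq⟩ := ho h0
  cases hds : dests d with
  | none => exact ⟨s, by simp [invalidate, hs, hds], hq⟩
  | some rsn =>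
    refine ⟨_, by simp only [invalidate, hs, hds, Option.map_some]; rfl, .inl ?_⟩
    have := hd d rsn s hds hs (by omega)
    change sn < rsn
    omega

theorem Justified.invalidate {F : Facts IP} {rt : RT IP} (hrt : Justified F rt)
    (dests : Dests IP) : Justified F (invalidate rt dests) := by
  intro d e he
  obtain ⟨r, hr, rfl⟩ := Option.map_eq_some_iff.1 he
  cases hds : dests d with
  | none => exact hrt d r hr
  | some rsn => exact ⟨(hrt d r hr).1, nofun⟩

theorem brokenDests_exceeds (rt : RT IP) (dip : IP) : Exceeds (brokenDests rt dip) rt := by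
  intro d rsn r hd hr h0
  unfold brokenDests at hd
  split_ifs at hd
  simp only [sqn, hr, inc, h0, if_false, Option.some_inj] at hd
  omega

theorem affectedDests_exceeds (rt : RT IP) (dests : Dests IP) (sip : IP) :
    Exceeds (affectedDests rt dests sip) rt := by
  intro d rsn r hd hr _
  obtain ⟨rsn', _, h⟩ := Option.bind_eq_some_iff.1 hd
  split_ifs at h with hc
  cases h
  simpa [sqn, hr] using hc.2.2

end Bounds

/-! ### Safety of the processes of AODV -/

section Processes

variable {IP Data : Type}

/-- The contract of the main process of a node. -/
def mainContract (IP Data : Type) :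
    Contract (Facts IP) (Msg IP Data) (PName IP Data) (Vars IP Data) where
  call F
    | .rreq hops rreqid dip dsn dsk oip osn sip =>
      Msg.Sound F (.rreq hops rreqid dip dsn dsk oip osn sip : Msg IP Data)
    | .rrep hops dip dsn oip sip => Msg.Sound F (.rrep hops dip dsn oip sip : Msg IP Data)
    | _ => True
  assign F ξ ξ' := ξ'.ip = ξ.ip ∧ OffersLE ξ.rt ξ'.rt ∧ Justified F ξ'.rt
  cast _ ξ m := m.Sound fun sip dip sn h => sip = ξ.ip ∧ Offers ξ.rt dip sn h
  send _ _ _ := False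
  inp := Msg.Sound

/-- The contract of the message queue. -/
def queueContract (IP Data : Type) :
    Contract (Facts IP) (Msg IP Data) (List (Msg IP Data)) Unit where
  call F msgs := ∀ m ∈ msgs, m.Sound F
  assign _ _ _ := True
  cast _ _ _ := False
  send F _ := Msg.Sound F
  inp := Msg.Sound

/-- Facts occur only positively, as evidence. Casts are judged against the sender's own table,
independently of the world. -/
theorem mainContract_persistent : (mainContract IP Data).Persistent where
  call {_ _ x} hF h := by
    cases x with
    | rreq | rrep => exact fun hne => hF _ _ _ _ (h hne)
    | _ => exact trivial
  assign hF h := ⟨h.1, h.2.1, h.2.2.mono hF⟩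
  cast _ h := h
  send _ h := h

theorem queueContract_persistent : (queueContract IP Data).Persistent where
  call hF h m hm := (h m hm).mono hF
  assign _ h := h
  cast _ h := h
  send hF h := h.mono hF

/-- The queue merely stores and forwards; queued messages stay sound as facts accumulate. -/
theorem qmsgDefs_safe {F : Facts IP} (msgs : List (Msg IP Data))
    (h : ∀ m ∈ msgs, m.Sound F) : (qmsgDefs msgs).Safe (queueContract IP Data) F () := by
  have recv (F' : Facts IP) (hF : F ≤ F') (m : Msg IP Data) (hm : m.Sound F') :
      ∀ m' ∈ msgs ++ [m], m'.Sound F' := by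
    intro m' hm'
    rcases List.mem_append.1 hm' with h' | h'
    · exact (h m' h').mono hF
    · rwa [List.mem_singleton.1 h']
  exact ⟨recv, fun _ _ => ⟨⟨fun m hm => h m (List.mem_of_head? hm),
    fun m hm => h m (List.mem_of_mem_tail hm)⟩, recv⟩⟩

/-! ### Rules for assignments and shared subroutines -/

theorem safe_assignRT {F : Facts IP} {ξ : Vars IP Data} {u : Vars IP Data → Option (RT IP)}
    {p : Proc IP Data}
    (h : ∀ rt, u ξ = some rt → OffersLE ξ.rt rt ∧ Justified F rt ∧
      p.Safe (mainContract IP Data) F { ξ with rt := rt }) :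
    (assignRT u p).Safe (mainContract IP Data) F ξ := by
  intro ξ' hξ'
  obtain ⟨rt, hrt, rfl⟩ := Option.map_eq_some_iff.1 hξ'
  exact ⟨⟨rfl, (h rt hrt).1, (h rt hrt).2.1⟩, (h rt hrt).2.2⟩

theorem safe_assignStore {F : Facts IP} {ξ : Vars IP Data}
    {u : Vars IP Data → Option (Store IP Data)} {p : Proc IP Data} (hξ : Justified F ξ.rt)
    (h : ∀ store, p.Safe (mainContract IP Data) F { ξ with store := store }) :
    (assignStore u p).Safe (mainContract IP Data) F ξ := by
  intro ξ' hξ'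
  obtain ⟨store, -, rfl⟩ := Option.map_eq_some_iff.1 hξ'
  exact ⟨⟨rfl, .refl _, hξ⟩, h store⟩

theorem safe_assignSN {F : Facts IP} {ξ : Vars IP Data} {u : Vars IP Data → ℕ}
    {p : Proc IP Data} (hξ : Justified F ξ.rt)
    (h : ∀ sn, p.Safe (mainContract IP Data) F { ξ with sn := sn }) :
    (assignSN u p).Safe (mainContract IP Data) F ξ := by
  intro ξ' hξ'
  cases hξ'
  exact ⟨⟨rfl, .refl _, hξ⟩, h _⟩

theorem safe_addRreq {F : Facts IP} {ξ : Vars IP Data} {x : Vars IP Data → IP × ℕ}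
    {p : Proc IP Data} (hξ : Justified F ξ.rt)
    (h : ∀ rreqs, p.Safe (mainContract IP Data) F { ξ with rreqs := rreqs }) :
    (addRreq x p).Safe (mainContract IP Data) F ξ := by
  intro ξ' hξ'
  cases hξ'
  exact ⟨⟨rfl, .refl _, hξ⟩, h _⟩

/-- An error message advertises no route and is sound trivially, so only the invalidation matters.
-/
theorem safe_routeError {F : Facts IP} {ξ : Vars IP Data} {dests : Dests IP}
    (hξ : Justified F ξ.rt) (hd : Exceeds dests ξ.rt) :
    (routeError dests : Proc IP Data).Safe (mainContract IP Data) F ξ := by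
  refine safe_assignRT fun rt hrt => ?_
  cases hrt
  exact ⟨invalidate_offersLE hd, hξ.invalidate dests,
    safe_assignStore (hξ.invalidate dests) fun _ _ _ _ _ =>
      ⟨fun m hm => by cases hm; exact trivial, trivial⟩⟩

theorem safe_linkBreak {F : Facts IP} {ξ : Vars IP Data} (hξ : Justified F ξ.rt) (dip : IP) :
    (linkBreak dip : Proc IP Data).Safe (mainContract IP Data) F ξ := by
  intro dests hd
  cases hd
  exact safe_routeError hξ (brokenDests_exceeds _ _)

/-- The next hop of the inserted route is its destination, so no evidence is needed. -/
theorem safe_updateSender {F : Facts IP} {ξ : Vars IP Data} {sip : IP} {p : Proc IP Data}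
    (hξ : Justified F ξ.rt)
    (h : ∀ rt, p.Safe (mainContract IP Data) F { ξ with rt := rt }) :
    (updateSender sip p).Safe (mainContract IP Data) F ξ :=
  safe_assignRT fun rt hrt =>
    ⟨update_offersLE hξ hrt, hξ.update hrt le_rfl fun hne => absurd rfl hne, h rt⟩

/-! ### The defining equations -/

theorem AODVdef_safe {F : Facts IP} {ξ : Vars IP Data} (hξ : Justified F ξ.rt) :
    (AODVdef : Proc IP Data).Safe (mainContract IP Data) F ξ := by
  refine ⟨fun F' hF m hm => ?_, ?_, ?_⟩
  · replace hξ := hξ.mono hF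
    refine ⟨?_, ?_, ?_, ?_, ?_⟩
    · exact fun _ _ => trivial
    · exact fun _ _ => trivial
    · rintro ⟨hops, rreqid, dip, dsn, dsk, oip, osn, sip⟩ rfl
      exact safe_updateSender hξ fun _ => hm
    · rintro ⟨hops, dip, dsn, oip, sip⟩ rfl
      exact safe_updateSender hξ fun _ => hm
    · rintro ⟨dests, sip⟩ rfl
      exact safe_updateSender hξ fun _ => trivial
  · intro dip _ data _
    exact ⟨fun m hm => by cases hm; exact trivial, safe_assignStore hξ fun _ => trivial,
      safe_linkBreak hξ dip⟩
  · intro dip _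
    refine safe_assignStore hξ fun _ => safe_assignSN hξ fun _ rreqid _ =>
      safe_addRreq hξ fun _ => ⟨fun m hm => ?_, trivial⟩
    cases hm
    -- The sender of a new request is its originator, so nothing has to be offered.
    exact fun hne => absurd rfl hne

theorem NEWPKTdef_safe {F : Facts IP} {ξ : Vars IP Data} (hξ : Justified F ξ.rt) (data : Data)
    (dip : IP) : (NEWPKTdef data dip).Safe (mainContract IP Data) F ξ :=
  ⟨fun _ _ => trivial, fun _ _ => safe_assignStore hξ fun _ => trivial⟩

theorem PKTdef_safe {F : Facts IP} {ξ : Vars IP Data} (hξ : Justified F ξ.rt) (data : Data)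
    (dip oip : IP) : (PKTdef data dip oip).Safe (mainContract IP Data) F ξ :=
  ⟨fun _ _ => trivial, fun _ _ =>
    ⟨fun _ _ => ⟨fun m hm => by cases hm; exact trivial, trivial, safe_linkBreak hξ dip⟩,
      fun _ _ => ⟨fun _ _ => ⟨fun m hm => by cases hm; exact trivial, trivial⟩,
        fun _ _ => trivial⟩⟩⟩

/-- A reply by the destination is sound because sender and destination coincide; a reply by another
node quotes its valid entry; a re-broadcast quotes the route just fed into `update`. -/
theorem RREQdef_safe {F : Facts IP} {ξ : Vars IP Data} (hξ : Justified F ξ.rt)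
    (hops rreqid : ℕ) (dip : IP) (dsn : ℕ) (dsk : SqnStatus) (oip : IP) (osn : ℕ) (sip : IP)
    (hm : sip ≠ oip → F sip oip osn hops) :
    (RREQdef hops rreqid dip dsn dsk oip osn sip : Proc IP Data).Safe (mainContract IP Data) F ξ := by
  refine ⟨fun _ _ => trivial, fun _ _ => safe_assignRT fun rt hrt => ?_⟩
  -- The increment of the hop count is the source of the strict inequality in `Justified`.
  have hrt' : Justified F rt := hξ.update hrt (Nat.le_add_left 1 hops) fun hne =>
    ⟨rfl, hops, Nat.lt_succ_self _, hm hne⟩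
  refine ⟨update_offersLE hξ hrt, hrt', safe_addRreq hrt' fun _ => ⟨fun _ hdip => ?_, fun _ _ => ⟨?_, ?_⟩⟩⟩
  · refine safe_assignSN hrt' fun _ => ⟨fun m hm => ?_, trivial, safe_linkBreak hrt' oip⟩
    cases hm
    exact fun hne => absurd hdip.symm hne
  · intro _ hv
    refine safe_assignRT fun rt₁ h₁ => ⟨addpreRT_offersLE h₁, hrt'.addpreRT h₁, ?_⟩
    refine safe_assignRT fun rt₂ h₂ => ?_
    obtain ⟨nh, -, h₂⟩ := Option.bind_eq_some_iff.1 h₂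
    have hrt₂ := (hrt'.addpreRT h₁).addpreRT h₂
    refine ⟨addpreRT_offersLE h₂, hrt₂, fun m hm => ?_, trivial, safe_linkBreak hrt₂ oip⟩
    obtain ⟨h, hh, rfl⟩ := Option.map_eq_some_iff.1 hm
    refine fun _ => ⟨rfl, ?_⟩
    exact offers_of_mem_vD (addpreRT_vD h₂ (addpreRT_vD h₁ hv.1)) hh
  · exact fun _ _ => ⟨fun m hm => by cases hm; exact fun _ => ⟨rfl, update_offers hrt rfl⟩, trivial⟩

/-- The forwarded reply quotes the incoming message, not the table entry. By `update_offers` the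
table offers at least that much, and adding precursors preserves it. -/
theorem RREPdef_safe {F : Facts IP} {ξ : Vars IP Data} (hξ : Justified F ξ.rt)
    (hops : ℕ) (dip : IP) (dsn : ℕ) (oip sip : IP) (hm : sip ≠ dip → F sip dip dsn hops) :
    (RREPdef hops dip dsn oip sip : Proc IP Data).Safe (mainContract IP Data) F ξ := by
  refine ⟨fun _ _ => safe_assignRT fun rt hrt => ?_, fun _ _ => trivial⟩
  have hrt' : Justified F rt := hξ.update hrt (Nat.le_add_left 1 hops) fun hne =>
    ⟨rfl, hops, Nat.lt_succ_self _, hm hne⟩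
  refine ⟨update_offersLE hξ hrt, hrt', fun _ _ => trivial, fun _ _ =>
    ⟨fun _ _ => ?_, fun _ _ => trivial⟩⟩
  refine safe_assignRT fun rt₁ h₁ => ?_
  obtain ⟨nh, -, h₁⟩ := Option.bind_eq_some_iff.1 h₁
  refine ⟨addpreRT_offersLE h₁, hrt'.addpreRT h₁, safe_assignRT fun rt₂ h₂ => ?_⟩
  obtain ⟨nh₁, -, h₂⟩ := Option.bind_eq_some_iff.1 h₂
  obtain ⟨nh₂, -, h₂⟩ := Option.bind_eq_some_iff.1 h₂
  have hrt₂ := (hrt'.addpreRT h₁).addpreRT h₂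
  refine ⟨addpreRT_offersLE h₂, hrt₂, fun m hm => ?_, trivial, safe_linkBreak hrt₂ oip⟩
  cases hm
  exact fun _ => ⟨rfl, addpreRT_offersLE h₂ _ _ _ (addpreRT_offersLE h₁ _ _ _
    (update_offers hrt rfl))⟩

theorem aodvDefs_safe {F : Facts IP} {ξ : Vars IP Data} (hξ : Justified F ξ.rt)
    (x : PName IP Data) (hx : (mainContract IP Data).call F x) :
    (aodvDefs x).Safe (mainContract IP Data) F ξ := by
  cases x with
  | aodv => exact AODVdef_safe hξ
  | newpkt data dip => exact NEWPKTdef_safe hξ data dip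
  | pkt data dip oip => exact PKTdef_safe hξ data dip oip
  | rreq hops rreqid dip dsn dsk oip osn sip =>
    exact RREQdef_safe hξ hops rreqid dip dsn dsk oip osn sip hx
  | rrep hops dip dsn oip sip => exact RREPdef_safe hξ hops dip dsn oip sip hx
  | rerr dests sip =>
    intro dests' hd
    cases hd
    exact safe_routeError hξ (affectedDests_exceeds _ _ _)

end Processes

/-! ### Invariants of nodes and networks -/

section Invariants

variable {IP Data : Type}

/-- The invariant of a node, relative to known facts. -/
structure NodeState.Inv (F : Facts IP) (s : NodeState IP Data) : Prop where
  justified : Justified F s.vars.rt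
  proc : s.proc.Safe (mainContract IP Data) F s.vars
  queue : s.queue.Safe (queueContract IP Data) F ()

theorem NodeState.Inv.mono {F F' : Facts IP} {s : NodeState IP Data} (hF : F ≤ F')
    (h : s.Inv F) : s.Inv F' :=
  ⟨h.justified.mono hF, h.proc.mono mainContract_persistent hF,
    h.queue.mono queueContract_persistent hF⟩

/-- The address is kept and the offered routes persist. -/
def NodeState.Evolves (s s' : NodeState IP Data) : Prop :=
  s'.vars.ip = s.vars.ip ∧ OffersLE s.vars.rt s'.vars.rt

theorem NodeState.Evolves.refl (s : NodeState IP Data) : s.Evolves s := ⟨rfl, .refl _⟩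

theorem mainStep_inv {F : Facts IP} {s : NodeState IP Data} {a : Act IP Data (Msg IP Data)}
    {ξ' : Vars IP Data} {p' : Proc IP Data} (hs : s.Inv F)
    (h : SeqStep aodvDefs s.vars s.proc a ξ' p') (ha : ∀ m, a = .receive m → m.Sound F) :
    (ξ'.ip = s.vars.ip ∧ OffersLE s.vars.rt ξ'.rt) ∧ Justified F ξ'.rt ∧
      p'.Safe (mainContract IP Data) F ξ' ∧
      ∀ m, a.castMsg = some m → (mainContract IP Data).cast F s.vars m := by
  obtain ⟨h1, h2, h3, -⟩ := h.safe (aodvDefs_safe hs.justified) ha hs.proc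
  rcases h1 with rfl | h1
  · exact ⟨⟨rfl, .refl _⟩, hs.justified, h2, h3⟩
  · exact ⟨⟨h1.1, h1.2.1⟩, h1.2.2, h2, h3⟩

theorem ParStep.inv {F : Facts IP} {s s' : NodeState IP Data} {a : Act IP Data (Msg IP Data)}
    (h : ParStep s a s') (hs : s.Inv F) (ha : ∀ m, a = .receive m → m.Sound F) :
    (s'.Inv F ∧ s.Evolves s') ∧
      ∀ m, a.castMsg = some m → (mainContract IP Data).cast F s.vars m := by
  cases h with
  | main ha' h =>
    obtain ⟨h1, h2, h3, h4⟩ := mainStep_inv hs h ha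
    exact ⟨⟨⟨h2, h3, hs.queue⟩, h1⟩, h4⟩
  | queue ha' h =>
    obtain ⟨-, h2, h3, -⟩ :=
      h.safe (S := queueContract IP Data) (fun _ => qmsgDefs_safe _) ha hs.queue
    exact ⟨⟨⟨hs.justified, hs.proc, h2⟩, .refl _⟩, fun m hm => (h3 m hm).elim⟩
  | sync hp hq =>
    obtain ⟨-, h2, -, h3⟩ :=
      hq.safe (S := queueContract IP Data) (fun _ => qmsgDefs_safe _) nofun hs.queue
    -- The queue's guarantee for its output is the input assumption of the main process.
    obtain ⟨h4, h5, h6, -⟩ := mainStep_inv hs hp fun m hm => by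
      cases hm; exact h3 _ rfl
    exact ⟨⟨⟨h5, h6, h2⟩, h4⟩, nofun⟩

theorem NodeStep.inv {F : Facts IP} {s s' : NodeState IP Data} {a : NodeAct IP Data}
    (h : NodeStep s a s') (hs : s.Inv F) (ha : ∀ m, a = .arrive m → m.Sound F) :
    (s'.Inv F ∧ s.Evolves s') ∧
      ∀ D m, a = .cast D m → (mainContract IP Data).cast F s.vars m := by
  cases h with
  | broadcast h | groupcast h | unicast h =>
    obtain ⟨h1, h2⟩ := h.inv hs nofun
    exact ⟨h1, fun D m hm => by cases hm; exact h2 _ rfl⟩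
  | unicastFails h | tau h | deliver h => exact ⟨(h.inv hs nofun).1, nofun⟩
  | arrive h => exact ⟨(h.inv hs fun m hm => ha m (by cases hm; rfl)).1, nofun⟩

variable {nodes : Finset IP}

/-- The routes offered by the nodes of a network. -/
def Network.facts (N : Network nodes Data) : Facts IP := fun sip dip sn h =>
  ∃ i : nodes, (i : IP) = sip ∧ Offers (N.rt i) dip sn h

/-- The invariant of the network. -/
def Network.Inv (N : Network nodes Data) : Prop :=
  ∀ i, (N i).vars.ip = i ∧ (N i).Inv N.facts

/-- All nodes can be checked against the facts before the step, since these remain facts afterwards.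
-/
theorem Network.Inv.of_evolves {N N' : Network nodes Data} (hN : N.Inv)
    (h : ∀ i, (N' i).Inv N.facts ∧ (N i).Evolves (N' i)) : N'.Inv := fun i =>
  ⟨(h i).2.1.trans (hN i).1, (h i).1.mono fun _ _ _ _ ⟨j, hj, ho⟩ => ⟨j, hj, (h j).2.2 _ _ _ ho⟩⟩

theorem Network.Inv.sound {N : Network nodes Data} (hN : N.Inv) {i : nodes} {m : Msg IP Data}
    (h : (mainContract IP Data).cast N.facts (N i).vars m) : m.Sound N.facts :=
  Msg.Sound.mono (fun _ _ _ _ hf => ⟨i, (hN i).1.symm.trans hf.1.symm, hf.2⟩) h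

theorem NetStep.inv {N N' : Network nodes Data} (h : NetStep N N') (hN : N.Inv) : N'.Inv := by
  refine hN.of_evolves fun j => ?_
  have stay (h : N' j = N j) : (N' j).Inv N.facts ∧ (N j).Evolves (N' j) := by
    rw [h]; exact ⟨(hN j).2, .refl _⟩
  cases h with
  | cast i hi hin hout =>
    obtain ⟨h1, h2⟩ := hi.inv (hN i).2 nofun
    by_cases hj : j = i
    · subst hj
      exact h1
    · rename_i D m
      by_cases hD : (j : IP) ∈ D
      · refine ((hin j hj hD).inv (hN j).2 fun m' hm' => ?_).1
        cases hm'
        exact hN.sound (h2 _ _ rfl)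
      · exact stay (hout j hj hD)
  | tau i hi hout | deliver i hi hout =>
    by_cases hj : j = i
    · subst hj
      exact (hi.inv (hN j).2 nofun).1
    · exact stay (hout j hj)
  | newpkt i hi hout =>
    by_cases hj : j = i
    · subst hj
      exact (hi.inv (hN j).2 fun m hm => by cases hm; exact trivial).1
    · exact stay (hout j hj)
  | connect a b | disconnect a b =>
    -- Transmission ranges do not enter the invariant.
    exact ⟨⟨(hN j).2.justified, (hN j).2.proc, (hN j).2.queue⟩, rfl, .refl _⟩

theorem Initial.inv {N : Network nodes Data} (h : Initial N) : N.Inv := by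
  intro i
  obtain ⟨hv, hp, hq⟩ := h i
  refine ⟨by rw [hv], ?_, ?_, ?_⟩
  · rw [hv]; exact fun _ _ => nofun
  · rw [hp]; exact trivial
  · rw [hq]; exact fun _ => nofun

theorem Reachable.inv {N : Network nodes Data} (h : Reachable N) : N.Inv := by
  obtain ⟨N₀, h0, h⟩ := h
  induction h with
  | refl => exact h0.inv
  | tail _ hs ih => exact hs.inv ih

end Invariants

end AODV

theorem mainTheorem2 {IP Data : Type} (nodes : Finset IP) (N : AODV.Network nodes Data)
    (hN : AODV.Reachable N) (ip nhip : nodes) (dip : IP)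
    (hip : dip ∈ AODV.vD (N.rt ip)) (hnhip : dip ∈ AODV.vD (N.rt nhip))
    (hnext : AODV.nhop (N.rt ip) dip = some (nhip : IP)) (hne : (nhip : IP) ≠ dip) :
    AODV.QualityLT dip (N.rt ip) (N.rt nhip) := by
  obtain ⟨r, hr, hv⟩ := hip
  obtain ⟨r', hr', hv'⟩ := hnhip
  have hnh : r.nhip = nhip := by simpa [AODV.nhop, hr] using hnext
  obtain ⟨h0, h, hlt, j, hj, ho⟩ := ((hN.inv ip).2.justified dip r hr).2 hv (hnh ▸ hne)
  obtain rfl : j = nhip := Subtype.ext (hj.trans hnh)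
  obtain ⟨s, hs, hq⟩ := ho h0
  obtain rfl : r' = s := Option.some_inj.1 (hr'.symm.trans hs)
  have hn : r.nsqn = r.dsn := by simp [AODV.Entry.nsqn, hv]
  have hn' : r'.nsqn = r'.dsn := by simp [AODV.Entry.nsqn, hv']
  refine ⟨⟨r, r', hr, hr', ?_⟩, ?_⟩
  -- Either the number at the next hop is larger, or the numbers agree and its hop count is at most
  -- `h < r.hops`.
  · unfold AODV.Entry.QualityLE
    omega
  · rintro ⟨-, t', t, ht', ht, hle⟩
    obtain rfl : r' = t' := Option.some_inj.1 (hr'.symm.trans ht')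
    obtain rfl : r = t := Option.some_inj.1 (hr.symm.trans ht)
    unfold AODV.Entry.QualityLE at hle
    omega
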